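/- Let $(\zeta_n)_{n\ge 1}$ be independent, identically distributed complex random variables that are rotationally invariant ($e^{i\theta}\zeta_n$ has the same law as $\zeta_n$ for every real $\theta$) with $\mathbb{E}|\zeta_n|^2=1$, and let $(a_n)_{n\ge 1}$ be a deterministic sequence of nonnegative real numbers with $\sum_{n\ge 1} a_n^2<\infty$ and $\limsup_{n\to\infty} a_n^{1/n}=1$. Consider the random power series $$F(z)=\sum_{n\ge 1}\zeta_n a_n z^n$$ (whose radius of convergence is almost surely $1$). If $F$ is almost surely unbounded on the open unit disk $\mathbb{D}=\{z\in\mathbb{C}:|z|<1\}$, then almost surely the image $F(\mathbb{D})$ is dense in $\mathbb{C}$. -/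

import Mathlib

/-- The random Taylor series `F(z) = ∑_{n ≥ 1} ζ_n a_n z^n`, for the outcome `ω`. The summation starts
at `n = 1`, so that the values `ζ 0` and `a 0` play no role. -/
noncomputable def randomTaylorSeries {Ω : Type*} (ζ : ℕ → Ω → ℂ) (a : ℕ → ℝ) (ω : Ω) (z : ℂ) : ℂ :=
  ∑' n : ℕ, ζ (n + 1) ω * (a (n + 1) : ℂ) * z ^ (n + 1)

/-! Fix `w` and `δ`. Given the first `n` coefficients, the series is `p + R`, with `p` a polynomial
vanishing at `0` and `R` a random tail, small in mean square uniformly on the disk once `n` is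
large. By rotational invariance `R` and `u R` have the same law for unimodular `u`. Either `p` comes
close to `w` at a point of the disk, where `R` is probably small, or the minimum principle for `p -
w` gives a boundary point `ξ` with `‖p ξ - w‖ ≤ ‖w‖`. In the latter case `R` is almost surely
unbounded near `ξ` (`ae_mem_unboundedNear`) and probably small at some point near `ξ`, so `‖R‖ = ‖p
- w‖` somewhere in between and a rotation of `R` makes the sum equal to `w`
(`exists_point_and_sector`). A finite net of rotations, depending only on `w` and `δ`, turns this
into a lower bound for the conditional probability of coming within `δ` of `w`, uniform in the given
coefficients. The zero-one law `ae_of_le_measure_splice` raises that probability to one. -/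

open MeasureTheory Filter Topology Set
open TopologicalSpace (denseSeq denseRange_denseSeq)
open scoped ENNReal

/-! ### Conditioning on initial coordinates and a zero-one law -/

/-- The sequence that agrees with `x` before index `n` and with `y` from index `n` on. -/
def splice {α : Type*} (n : ℕ) (x y : ℕ → α) : ℕ → α := fun i => if i < n then x i else y i

lemma measurable_splice {α : Type*} [MeasurableSpace α] (n : ℕ) :
    Measurable fun p : (ℕ → α) × (ℕ → α) => splice n p.1 p.2 := by
  refine measurable_pi_lambda _ fun i => ?_
  by_cases hi : i < n
  · simp only [splice, hi, if_true]
    fun_prop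
  · simp only [splice, hi, if_false]
    fun_prop

lemma measurable_splice_right {α : Type*} [MeasurableSpace α] (n : ℕ) (x : ℕ → α) :
    Measurable fun y : ℕ → α => splice n x y :=
  (measurable_splice n).comp measurable_prodMk_left

/-- Splicing two independent sequences with i.i.d. entries gives a sequence of the same law. -/
lemma map_splice_prod {α : Type*} [MeasurableSpace α] (ν : Measure α) [IsProbabilityMeasure ν]
    (n : ℕ) :
    ((Measure.infinitePi fun _ : ℕ => ν).prod (Measure.infinitePi fun _ : ℕ => ν)).map
      (fun p => splice n p.1 p.2) = Measure.infinitePi fun _ : ℕ => ν := by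
  refine Measure.eq_infinitePi _ fun s t ht => ?_
  rw [Measure.map_apply (measurable_splice n) (.pi s.countable_toSet fun i _ => ht i)]
  have : (fun p : (ℕ → α) × (ℕ → α) => splice n p.1 p.2) ⁻¹' (Set.pi s t) =
      (Set.pi (s.filter (· < n) : Finset ℕ) t) ×ˢ (Set.pi (s.filter (¬ · < n) : Finset ℕ) t) := by
    ext p
    simp only [mem_preimage, Set.mem_pi, mem_prod, Finset.coe_filter, mem_ofPred_eq, splice,
      Finset.mem_coe]
    constructor
    · intro h
      refine ⟨fun i hi => ?_, fun i hi => ?_⟩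
      · simpa [hi.2] using h i hi.1
      · simpa [hi.2] using h i hi.1
    · intro h i hi
      by_cases hn : i < n
      · simpa [hn] using h.1 i ⟨hi, hn⟩
      · simpa [hn] using h.2 i ⟨hi, hn⟩
  rw [this, Measure.prod_prod, Measure.infinitePi_pi _ fun i _ => ht i,
    Measure.infinitePi_pi _ fun i _ => ht i, Finset.prod_filter_mul_prod_filter_not]

/-- A measurable event whose conditional probability given finitely many initial coordinates
is bounded below by a positive constant has full measure. -/
lemma ae_of_le_measure_splice {α : Type*} [MeasurableSpace α] (ν : Measure α)
    [IsProbabilityMeasure ν] {A : Set (ℕ → α)} (hA : MeasurableSet A) {c : ℝ≥0∞} (hc : c ≠ 0)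
    (n₀ : ℕ)
    (h : ∀ n, n₀ ≤ n → ∀ x : ℕ → α,
      c ≤ (Measure.infinitePi fun _ : ℕ => ν) {y | splice n x y ∈ A}) :
    ∀ᵐ y ∂(Measure.infinitePi fun _ : ℕ => ν), y ∈ A := by
  set μ := Measure.infinitePi fun _ : ℕ => ν with hμ
  have hα : Nonempty α := ν.nonempty_of_neZero
  have hc1 : c ≤ 1 := (h n₀ le_rfl (fun _ => Classical.arbitrary α)).trans prob_le_one
  -- Approximate `Aᶜ` within `ε` by a cylinder. Given its coordinates, `A` still has probability at
  -- least `c`, yet `A` meets the cylinder in measure at most `ε`.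
  have key : ∀ ε : ℝ≥0∞, 0 < ε → c * μ Aᶜ ≤ ε + ε := by
    intro ε hε
    obtain ⟨B, hB, hBA⟩ := exists_measure_symmDiff_lt_of_generateFrom_isSetRing (μ := μ)
      (C := measurableCylinders fun _ : ℕ => α) isSetRing_measurableCylinders
      ⟨{univ}, by simp, by simpa using univ_mem_measurableCylinders (fun _ : ℕ => α), by simp⟩
      generateFrom_measurableCylinders.symm hA.compl hε
    have hBm : MeasurableSet B := MeasurableSet.of_mem_measurableCylinders hB
    obtain ⟨s, S, hS, rfl⟩ := (mem_measurableCylinders _).1 hB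
    obtain ⟨N, hN⟩ := s.exists_nat_subset_range
    set n := max N n₀
    have hsplice : ∀ x y : ℕ → α, splice n x y ∈ cylinder s S ↔ x ∈ cylinder s S := by
      intro x y
      have : s.restrict (splice n x y) = s.restrict x := by
        ext i
        have hi : (i : ℕ) < n := (Finset.mem_range.1 (hN i.2)).trans_le (le_max_left _ _)
        simp [splice, hi]
      rw [mem_cylinder, mem_cylinder, this]
    have h1 : c * μ (cylinder s S) ≤ μ (A ∩ cylinder s S) := by
      conv_rhs => rw [hμ, ← map_splice_prod ν n]
      rw [Measure.map_apply (measurable_splice n) (hA.inter hBm),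
        Measure.prod_apply (measurable_splice n (hA.inter hBm))]
      calc c * μ (cylinder s S) = ∫⁻ x in cylinder s S, c ∂μ := by simp
        _ ≤ ∫⁻ x in cylinder s S, μ (Prod.mk x ⁻¹'
            ((fun p : (ℕ → α) × (ℕ → α) => splice n p.1 p.2) ⁻¹' (A ∩ cylinder s S))) ∂μ := by
          refine setLIntegral_mono' hBm fun x hx => ?_
          refine (h n (le_max_right _ _) x).trans (measure_mono fun y hy => ?_)
          exact ⟨hy, (hsplice x y).2 hx⟩
        _ ≤ _ := setLIntegral_le_lintegral _ _
    have h2 : μ (A ∩ cylinder s S) ≤ ε := by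
      refine (measure_mono ?_).trans hBA.le
      rintro x ⟨hxA, hxB⟩
      exact Or.inl ⟨hxB, fun h => h hxA⟩
    have h3 : μ Aᶜ ≤ μ (cylinder s S) + ε := by
      refine (measure_mono (t := cylinder s S ∪ (symmDiff (cylinder s S) Aᶜ)) ?_).trans
        ((measure_union_le _ _).trans (by gcongr))
      intro x hx
      by_cases hxB : x ∈ cylinder s S
      · exact Or.inl hxB
      · exact Or.inr (Or.inr ⟨hx, hxB⟩)
    calc c * μ Aᶜ ≤ c * (μ (cylinder s S) + ε) := by gcongr
      _ = c * μ (cylinder s S) + c * ε := mul_add _ _ _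
      _ ≤ ε + 1 * ε := by gcongr; exact h1.trans h2
      _ = ε + ε := by rw [one_mul]
  have h0 : c * μ Aᶜ = 0 := by
    refine le_antisymm (le_of_forall_gt fun ε hε => ?_) zero_le
    obtain ⟨ε', h0', hlt⟩ := exists_between hε
    refine ((key (ε' / 2) (ENNReal.half_pos h0'.ne')).trans_eq (ENNReal.add_halves _)).trans_lt hlt
  exact (mul_eq_zero.1 h0).resolve_left hc

/-! ### Measurability, rotations and second moments -/

/-- Pointwise sums of sequences of measurable complex functions are measurable, without any
summability assumption. -/
lemma measurable_tsum_complex {α : Type*} [MeasurableSpace α] {f : ℕ → α → ℂ}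
    (hf : ∀ n, Measurable (f n)) : Measurable fun x => ∑' n, f n x := by
  -- In `ℂ` summability is absolute summability, so off `S` the sum takes its default value `0`, as
  -- does the indicator.
  set S : Set α := {x | ∑' n, ‖f n x‖ₑ ≠ ⊤}
  have hS : MeasurableSet S :=
    (Measurable.tsum fun n => (hf n).enorm) (measurableSet_singleton ⊤).compl
  refine measurable_of_tendsto_metrizable
    (f := fun N => S.indicator fun x => ∑ i ∈ Finset.range N, f i x)
    (fun N => (Finset.measurable_sum _ fun i _ => hf i).indicator hS)
    (tendsto_pi_nhds.2 fun x => ?_)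
  have hiff : x ∈ S ↔ Summable fun n => f n x := by
    rw [← summable_norm_iff]
    change ∑' n, ‖f n x‖ₑ ≠ ⊤ ↔ _
    simp only [enorm_eq_nnnorm]
    rw [ENNReal.tsum_coe_ne_top_iff_summable, ← NNReal.summable_coe]
    rfl
  by_cases hx : x ∈ S
  · simpa [hx] using (hiff.1 hx).hasSum.tendsto_sum_nat
  · simp [hx, tsum_eq_zero_of_not_summable (mt hiff.2 hx)]

/-- Multiplying the entries by unimodular constants preserves the law of an i.i.d. sequence with
rotationally invariant marginals. -/
lemma map_rotate_infinitePi (ν : Measure ℂ) [IsProbabilityMeasure ν]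
    (hν : ∀ u : ℂ, ‖u‖ = 1 → ν.map (fun z => u * z) = ν) (u : ℕ → ℂ) (hu : ∀ n, ‖u n‖ = 1) :
    (Measure.infinitePi fun _ : ℕ => ν).map (fun y n => u n * y n) =
      Measure.infinitePi fun _ : ℕ => ν := by
  have := Measure.infinitePi_map_pi (fun _ : ℕ => ν) (f := fun n (z : ℂ) => u n * z)
    (fun n => measurable_const_mul _)
  rw [this]
  congr 1
  ext1 n
  exact hν _ (hu n)

lemma enorm_add_sq_add_enorm_sub_sq (s t : ℂ) :
    ‖s + t‖ₑ ^ 2 + ‖s - t‖ₑ ^ 2 = 2 * (‖s‖ₑ ^ 2 + ‖t‖ₑ ^ 2) := by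
  simp only [← ofReal_norm, ← ENNReal.ofReal_pow (norm_nonneg _)]
  rw [← ENNReal.ofReal_add (by positivity) (by positivity),
    ← ENNReal.ofReal_add (by positivity) (by positivity),
    show (2 : ℝ≥0∞) = ENNReal.ofReal 2 by simp, ← ENNReal.ofReal_mul (by norm_num)]
  congr 1
  have := parallelogram_law_with_norm ℝ s t
  nlinarith

/-- Orthogonality without expectations of products: flipping the sign of one coordinate preserves
the law, so the parallelogram identity removes the cross term. -/
lemma lintegral_enorm_sum_sq_le (ν : Measure ℂ) [IsProbabilityMeasure ν]
    (hν : ∀ u : ℂ, ‖u‖ = 1 → ν.map (fun z => u * z) = ν) (hν₂ : ∫⁻ z, ‖z‖ₑ ^ 2 ∂ν ≤ 1)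
    (c : ℕ → ℂ) (s : Finset ℕ) :
    ∫⁻ y, ‖∑ i ∈ s, y i * c i‖ₑ ^ 2 ∂(Measure.infinitePi fun _ : ℕ => ν) ≤
      ∑ i ∈ s, ‖c i‖ₑ ^ 2 := by
  set μ := Measure.infinitePi fun _ : ℕ => ν with hμ
  induction s using Finset.induction_on with
  | empty => simp
  | insert k s hk ih =>
    set S : (ℕ → ℂ) → ℂ := fun y => ∑ i ∈ s, y i * c i
    have hS : Measurable S := by fun_prop
    set X : (ℕ → ℂ) → ℂ := fun y => y k * c k
    have hX : Measurable X := by fun_prop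
    have hsum : ∀ y : ℕ → ℂ, ∑ i ∈ insert k s, y i * c i = S y + X y := by
      intro y
      rw [Finset.sum_insert hk, add_comm]
    have hXint : ∫⁻ y, ‖X y‖ₑ ^ 2 ∂μ ≤ ‖c k‖ₑ ^ 2 := by
      have : ∫⁻ y, ‖y k‖ₑ ^ 2 ∂μ = ∫⁻ z, ‖z‖ₑ ^ 2 ∂ν := by
        rw [← Measure.infinitePi_map_eval (fun _ : ℕ => ν) k,
          lintegral_map (by fun_prop) (by fun_prop)]
      simp only [X, enorm_mul, mul_pow]
      rw [lintegral_mul_const _ (by fun_prop), this]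
      exact mul_le_of_le_one_left' hν₂
    have hflip : ∫⁻ y, ‖S y + X y‖ₑ ^ 2 ∂μ = ∫⁻ y, ‖S y - X y‖ₑ ^ 2 ∂μ := by
      conv_lhs => rw [hμ, ← map_rotate_infinitePi ν hν (fun n => if n = k then -1 else 1)
        (fun n => by split_ifs <;> simp)]
      rw [lintegral_map (by fun_prop) (by fun_prop)]
      refine lintegral_congr fun y => ?_
      have h1 : S (fun n => (if n = k then -1 else 1) * y n) = S y :=
        Finset.sum_congr rfl fun i hi => by
          have : i ≠ k := fun h => hk (h ▸ hi)
          simp [this]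
      rw [h1]
      simp [X, sub_eq_add_neg]
    simp only [hsum, Finset.sum_insert hk]
    have h2 : 2 * ∫⁻ y, ‖S y + X y‖ₑ ^ 2 ∂μ ≤ 2 * (‖c k‖ₑ ^ 2 + ∑ i ∈ s, ‖c i‖ₑ ^ 2) := by
      calc 2 * ∫⁻ y, ‖S y + X y‖ₑ ^ 2 ∂μ
          = ∫⁻ y, (‖S y + X y‖ₑ ^ 2 + ‖S y - X y‖ₑ ^ 2) ∂μ := by
            rw [lintegral_add_left (by fun_prop), ← hflip, two_mul]
        _ = 2 * (∫⁻ y, ‖S y‖ₑ ^ 2 ∂μ + ∫⁻ y, ‖X y‖ₑ ^ 2 ∂μ) := by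
            simp only [enorm_add_sq_add_enorm_sub_sq]
            rw [lintegral_const_mul _ (by fun_prop), lintegral_add_left (by fun_prop)]
        _ ≤ _ := by
            rw [add_comm (‖c k‖ₑ ^ 2)]
            gcongr
    exact (ENNReal.mul_le_mul_iff_right (by simp) (by simp)).1 h2

/-! ### Power series with bounded coefficients -/

section

/-- The power series `∑ yₙ bₙ z^(n+1)`. -/
noncomputable def weightedSeries (b y : ℕ → ℂ) (z : ℂ) : ℂ := ∑' n, y n * b n * z ^ (n + 1)

/-- The coefficients `yₙ bₙ` are bounded. -/
def HasBoundedCoeffs (b y : ℕ → ℂ) : Prop := ∃ C : ℝ, ∀ n, ‖y n * b n‖ ≤ C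

variable {b y : ℕ → ℂ}

lemma HasBoundedCoeffs.summable (h : HasBoundedCoeffs b y) {z : ℂ} (hz : ‖z‖ < 1) :
    Summable fun n => y n * b n * z ^ (n + 1) := by
  obtain ⟨C, hC⟩ := h
  refine Summable.of_norm_bounded (g := fun n => C * ‖z‖ ^ (n + 1)) ?_ fun n => ?_
  · exact ((summable_nat_add_iff 1).2
      (summable_geometric_of_lt_one (norm_nonneg z) hz)).mul_left C
  · rw [norm_mul, norm_pow]
    gcongr
    exact hC n

lemma HasBoundedCoeffs.bounded_of_le (h : HasBoundedCoeffs b y) {r : ℝ} (hr : r < 1) :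
    ∃ M : ℝ, ∀ z : ℂ, ‖z‖ ≤ r → ‖weightedSeries b y z‖ ≤ M := by
  obtain ⟨C, hC⟩ := h
  by_cases hr0 : 0 ≤ r
  · have hs : Summable fun n : ℕ => C * r ^ (n + 1) :=
      ((summable_nat_add_iff 1).2 (summable_geometric_of_lt_one hr0 hr)).mul_left C
    refine ⟨∑' n : ℕ, C * r ^ (n + 1), fun z hz => ?_⟩
    refine tsum_of_norm_bounded hs.hasSum fun n => ?_
    rw [norm_mul, norm_pow]
    have hC0 : 0 ≤ C := (norm_nonneg _).trans (hC n)
    gcongr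
    exact hC n
  · exact ⟨0, fun z hz => absurd ((norm_nonneg z).trans hz) hr0⟩

lemma HasBoundedCoeffs.continuousOn (h : HasBoundedCoeffs b y) :
    ContinuousOn (weightedSeries b y) (Metric.ball 0 1) := by
  intro z hz
  rw [mem_ball_zero_iff] at hz
  obtain ⟨C, hC⟩ := h
  obtain ⟨r, hzr, hr⟩ := exists_between hz
  have hr0 : 0 ≤ r := (norm_nonneg z).trans hzr.le
  have hs : Summable fun n : ℕ => C * r ^ (n + 1) :=
    ((summable_nat_add_iff 1).2 (summable_geometric_of_lt_one hr0 hr)).mul_left C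
  have : ContinuousOn (weightedSeries b y) (Metric.ball 0 r) := by
    refine continuousOn_tsum (fun n => by fun_prop) hs fun n x hx => ?_
    rw [mem_ball_zero_iff] at hx
    rw [norm_mul, norm_pow]
    have hC0 : 0 ≤ C := (norm_nonneg _).trans (hC n)
    gcongr
    exact hC n
  exact (this.continuousAt (Metric.isOpen_ball.mem_nhds (by simpa using hzr))).continuousWithinAt

lemma HasBoundedCoeffs.spliced (h : HasBoundedCoeffs b y) (n : ℕ) (x : ℕ → ℂ) :
    HasBoundedCoeffs b (splice n x y) := by
  obtain ⟨C, hC⟩ := h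
  have hC0 : 0 ≤ C := (norm_nonneg _).trans (hC 0)
  refine ⟨C + ∑ i ∈ Finset.range n, ‖x i * b i‖, fun i => ?_⟩
  by_cases hi : i < n
  · simp only [splice, hi, if_true]
    have := Finset.single_le_sum (f := fun i => ‖x i * b i‖) (fun j _ => norm_nonneg _)
      (Finset.mem_range.2 hi)
    linarith
  · simp only [splice, hi, if_false]
    have : 0 ≤ ∑ i ∈ Finset.range n, ‖x i * b i‖ := by positivity
    linarith [hC i]

lemma HasBoundedCoeffs.weightedSeries_splice (h : HasBoundedCoeffs b y) (n : ℕ) (x : ℕ → ℂ)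
    {z : ℂ} (hz : ‖z‖ < 1) :
    weightedSeries b (splice n x y) z =
      ∑ i ∈ Finset.range n, x i * b i * z ^ (i + 1) +
        weightedSeries b (splice n 0 y) z := by
  have h0 : ∀ i ∉ Finset.range n, splice n x 0 i * b i * z ^ (i + 1) = 0 := by
    intro i hi
    simp [splice, Finset.mem_range.not.1 hi]
  have h1 : ∑ i ∈ Finset.range n, x i * b i * z ^ (i + 1) =
      ∑' i, splice n x 0 i * b i * z ^ (i + 1) := by
    rw [tsum_eq_sum h0]
    refine Finset.sum_congr rfl fun i hi => ?_
    simp [splice, Finset.mem_range.1 hi]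
  rw [h1, weightedSeries, weightedSeries,
    ← (summable_of_ne_finset_zero h0).tsum_add ((h.spliced n 0).summable hz)]
  refine tsum_congr fun i => ?_
  by_cases hi : i < n <;> simp [splice, hi]

lemma HasBoundedCoeffs.mul_unimodular (h : HasBoundedCoeffs b y) {u : ℕ → ℂ}
    (hu : ∀ n, ‖u n‖ = 1) : HasBoundedCoeffs b (fun n => u n * y n) := by
  obtain ⟨C, hC⟩ := h
  refine ⟨C, fun n => ?_⟩
  rw [mul_assoc, norm_mul, hu, one_mul]
  exact hC n

lemma weightedSeries_splice_zero_mul (b y : ℕ → ℂ) (n : ℕ) (u z : ℂ) :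
    weightedSeries b (splice n 0 fun i => u * y i) z = u * weightedSeries b (splice n 0 y) z := by
  rw [weightedSeries, weightedSeries, ← tsum_mul_left]
  refine tsum_congr fun i => ?_
  by_cases hi : i < n
  · simp [splice, hi]
  · simp [splice, hi, mul_assoc]

lemma weightedSeries_pow_mul (b y : ℕ → ℂ) (v z : ℂ) :
    weightedSeries b (fun n => v ^ (n + 1) * y n) z = weightedSeries b y (v * z) := by
  refine tsum_congr fun i => ?_
  rw [mul_pow]
  ring

lemma measurable_weightedSeries (b : ℕ → ℂ) (z : ℂ) :
    Measurable fun y => weightedSeries b y z :=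
  measurable_tsum_complex fun n => by fun_prop

/-! ### Almost sure bounds and small tails -/

lemma ae_hasBoundedCoeffs (ν : Measure ℂ) [IsProbabilityMeasure ν]
    (hν₂ : ∫⁻ z, ‖z‖ₑ ^ 2 ∂ν ≤ 1) (hb : ∑' n, ‖b n‖ₑ ^ 2 ≠ ⊤) :
    ∀ᵐ y ∂(Measure.infinitePi fun _ : ℕ => ν), HasBoundedCoeffs b y := by
  set μ := Measure.infinitePi fun _ : ℕ => ν with hμ
  have hX : ∀ n, ∫⁻ y, ‖y n * b n‖ₑ ^ 2 ∂μ ≤ ‖b n‖ₑ ^ 2 := by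
    intro n
    have : ∫⁻ y, ‖y n‖ₑ ^ 2 ∂μ = ∫⁻ z, ‖z‖ₑ ^ 2 ∂ν := by
      rw [← Measure.infinitePi_map_eval (fun _ : ℕ => ν) n,
        lintegral_map (by fun_prop) (by fun_prop)]
    simp only [enorm_mul, mul_pow]
    rw [lintegral_mul_const _ (by fun_prop), this]
    exact mul_le_of_le_one_left' hν₂
  have hm : ∀ n, Measurable fun y : ℕ → ℂ => ‖y n * b n‖ₑ ^ 2 := fun n => by fun_prop
  have hfin : ∫⁻ y, ∑' n, ‖y n * b n‖ₑ ^ 2 ∂μ ≠ ⊤ := by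
    rw [lintegral_tsum fun n => (hm n).aemeasurable]
    exact ne_top_of_le_ne_top hb (ENNReal.tsum_le_tsum hX)
  filter_upwards [ae_lt_top (Measurable.tsum hm) hfin] with y hy
  refine ⟨Real.sqrt (∑' n, ‖y n * b n‖ₑ ^ 2).toReal, fun n => Real.le_sqrt_of_sq_le ?_⟩
  have := ENNReal.toReal_mono hy.ne (ENNReal.le_tsum (f := fun n => ‖y n * b n‖ₑ ^ 2) n)
  simpa using this

/-- The tails of the random series are small in mean square, uniformly in the disk. -/
lemma lintegral_enorm_weightedSeries_splice_sq_le (ν : Measure ℂ) [IsProbabilityMeasure ν]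
    (hν : ∀ u : ℂ, ‖u‖ = 1 → ν.map (fun z => u * z) = ν) (hν₂ : ∫⁻ z, ‖z‖ₑ ^ 2 ∂ν ≤ 1)
    (hb : ∑' n, ‖b n‖ₑ ^ 2 ≠ ⊤) (n : ℕ) {z : ℂ} (hz : ‖z‖ < 1) :
    ∫⁻ y, ‖weightedSeries b (splice n 0 y) z‖ₑ ^ 2 ∂(Measure.infinitePi fun _ : ℕ => ν) ≤
      ∑' i, ‖b (i + n)‖ₑ ^ 2 := by
  set μ := Measure.infinitePi fun _ : ℕ => ν with hμ
  set c : ℕ → ℂ := fun i => if i < n then 0 else b i * z ^ (i + 1) with hc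
  have hcle : ∀ N, ∑ i ∈ Finset.range N, ‖c i‖ₑ ^ 2 ≤ ∑' i, ‖b (i + n)‖ₑ ^ 2 := by
    intro N
    refine (ENNReal.sum_le_tsum _).trans ?_
    rw [← ENNReal.summable.sum_add_tsum_nat_add' (k := n),
      Finset.sum_eq_zero, zero_add]
    · refine ENNReal.tsum_le_tsum fun i => ?_
      have : ‖z ^ (i + n + 1)‖ₑ ≤ 1 := by
        rw [← ofReal_norm, norm_pow]
        exact ENNReal.ofReal_le_one.2 (pow_le_one₀ (norm_nonneg z) hz.le)
      simp only [hc, add_lt_iff_neg_right, not_lt_zero, if_false, enorm_mul]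
      gcongr
      exact mul_le_of_le_one_right' this
    · intro i hi
      simp [hc, Finset.mem_range.1 hi]
  -- Writing the limit as a `liminf` lets Fatou's lemma carry the bound over from finite sums.
  have hlim : ∀ᵐ y ∂μ, ‖weightedSeries b (splice n 0 y) z‖ₑ ^ 2 =
      liminf (fun N => ‖∑ i ∈ Finset.range N, y i * c i‖ₑ ^ 2) atTop := by
    filter_upwards [ae_hasBoundedCoeffs ν hν₂ hb] with y hy
    have h1 := ((hy.spliced n 0).summable hz).hasSum.tendsto_sum_nat
    have h2 : (fun N => ∑ i ∈ Finset.range N, splice n 0 y i * b i * z ^ (i + 1)) =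
        fun N => ∑ i ∈ Finset.range N, y i * c i := by
      ext N
      refine Finset.sum_congr rfl fun i _ => ?_
      by_cases hi : i < n
      · simp [splice, hc, hi]
      · simp [splice, hc, hi, mul_assoc]
    rw [h2] at h1
    exact (((ENNReal.continuous_pow 2).tendsto _).comp
      ((continuous_enorm.tendsto _).comp h1)).liminf_eq.symm
  rw [lintegral_congr_ae hlim]
  refine (lintegral_liminf_le fun N => by fun_prop).trans ?_
  refine liminf_le_of_le ⟨0, by simp⟩ fun a ha => ?_
  obtain ⟨N, hN⟩ := ha.exists
  exact hN.trans ((lintegral_enorm_sum_sq_le ν hν hν₂ c _).trans (hcle N))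

/-- Chebyshev's inequality for a tail of variance below `η² / 2`. The threshold `n₀` must not depend
on `z`, since the point will be chosen from the first `n` coefficients. -/
lemma exists_forall_measure_weightedSeries_splice_lt (ν : Measure ℂ) [IsProbabilityMeasure ν]
    (hν : ∀ u : ℂ, ‖u‖ = 1 → ν.map (fun z => u * z) = ν) (hν₂ : ∫⁻ z, ‖z‖ₑ ^ 2 ∂ν ≤ 1)
    (hb : ∑' n, ‖b n‖ₑ ^ 2 ≠ ⊤) {η : ℝ} (hη : 0 < η) :
    ∃ n₀ : ℕ, ∀ n, n₀ ≤ n → ∀ z : ℂ, ‖z‖ < 1 →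
      2⁻¹ ≤ (Measure.infinitePi fun _ : ℕ => ν) {y | ‖weightedSeries b (splice n 0 y) z‖ < η} := by
  set μ := Measure.infinitePi fun _ : ℕ => ν with hμ
  set η' : ℝ≥0∞ := ENNReal.ofReal η ^ 2
  have hη' : 0 < η' := by
    have : 0 < ENNReal.ofReal η := ENNReal.ofReal_pos.2 hη
    positivity
  have hη't : η' ≠ ⊤ := by simp [η']
  have htend := ENNReal.tendsto_sum_nat_add (fun i => ‖b i‖ₑ ^ 2) hb
  have hev := htend.eventually (gt_mem_nhds (ENNReal.half_pos hη'.ne'))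
  obtain ⟨n₀, hn₀⟩ := eventually_atTop.1 hev
  refine ⟨n₀, fun n hn z hz => ?_⟩
  have hmeas : Measurable fun y : ℕ → ℂ => weightedSeries b (splice n 0 y) z :=
    (measurable_weightedSeries b z).comp (measurable_splice_right n 0)
  have hset : MeasurableSet {y : ℕ → ℂ | ‖weightedSeries b (splice n 0 y) z‖ < η} :=
    measurableSet_lt hmeas.norm measurable_const
  have hmarkov := mul_meas_ge_le_lintegral (μ := μ) (hmeas.enorm.pow_const 2) η'
  have hle : η' * μ {y : ℕ → ℂ | ‖weightedSeries b (splice n 0 y) z‖ < η}ᶜ ≤ η' / 2 := by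
    refine le_trans ?_ (hmarkov.trans
      ((lintegral_enorm_weightedSeries_splice_sq_le ν hν hν₂ hb n hz).trans (hn₀ n hn).le))
    gcongr
    intro y hy
    simp only [mem_compl_iff, mem_ofPred_eq, not_lt] at hy ⊢
    simp only [η', ← ofReal_norm]
    exact pow_le_pow_left' (ENNReal.ofReal_le_ofReal hy) 2
  have hle' : μ {y : ℕ → ℂ | ‖weightedSeries b (splice n 0 y) z‖ < η}ᶜ ≤ 2⁻¹ := by
    rw [div_eq_mul_inv] at hle
    exact (ENNReal.mul_le_mul_iff_right hη'.ne' hη't).1 hle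
  have hone := prob_add_prob_compl (μ := μ) hset
  by_contra hlt
  rw [not_le] at hlt
  have := ENNReal.add_lt_add_of_lt_of_le (ne_top_of_le_ne_top (by simp) hle') hlt hle'
  rw [hone, ENNReal.inv_two_add_inv_two] at this
  exact lt_irrefl _ this

/-! ### Deterministic choice of a point and a rotation -/

/-- A nonempty relatively open condition on an open set is met at a point of the dense sequence. -/
lemma exists_denseSeq_mem {g : ℂ → ℂ} {V O : Set ℂ} (hV : IsOpen V) (hg : ContinuousOn g V)
    (hO : IsOpen O) {z : ℂ} (hz : z ∈ V) (hgz : g z ∈ O) :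
    ∃ k, denseSeq ℂ k ∈ V ∧ g (denseSeq ℂ k) ∈ O := by
  obtain ⟨_, h, k, rfl⟩ := (denseRange_denseSeq ℂ).inter_open_nonempty _
    (hg.isOpen_inter_preimage hV hO) ⟨z, hz, hgz⟩
  exact ⟨k, h⟩

/-- An entire function `p` with `p 0 = 0` either comes close to `w` in the disk, or stays at
moderate distance from `w` near some point of the unit circle. -/
lemma exists_near_or_exists_boundary {p : ℂ → ℂ} (hp : Differentiable ℂ p) (hp0 : p 0 = 0)
    (w : ℂ) {η : ℝ} (hη : 0 < η) :
    (∃ z, ‖z‖ < 1 ∧ ‖p z - w‖ < η) ∨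
      ∃ ξ : ℂ, ‖ξ‖ = 1 ∧ ∃ r > 0, ∀ z, ‖z‖ < 1 → ‖z - ξ‖ < r →
        η ≤ ‖p z - w‖ ∧ ‖p z - w‖ ≤ ‖w‖ + η := by
  by_cases h : ∃ z, ‖z‖ < 1 ∧ ‖p z - w‖ < η
  · exact Or.inl h
  refine Or.inr ?_
  push Not at h
  have hcl : ∀ z ∈ Metric.closedBall (0 : ℂ) 1, η ≤ ‖p z - w‖ := by
    intro z hz
    rw [← closure_ball (0 : ℂ) one_ne_zero] at hz
    have hc : IsClosed {z | η ≤ ‖p z - w‖} :=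
      isClosed_le continuous_const (hp.continuous.sub continuous_const).norm
    exact closure_minimal (fun z hz => h z (by simpa using hz)) hc hz
  -- The maximum principle for `1 / (p - w)`, compared with its value `-1 / w` at the origin.
  have hξ : ∃ ξ : ℂ, ‖ξ‖ = 1 ∧ ‖p ξ - w‖ ≤ ‖w‖ := by
    by_contra hcon
    push Not at hcon
    obtain ⟨ξ, hξ, hmin⟩ := (isCompact_sphere (0 : ℂ) 1).exists_isMinOn
      (NormedSpace.sphere_nonempty.2 zero_le_one)
      (f := fun z => ‖p z - w‖) (hp.continuous.sub continuous_const).norm.continuousOn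
    have hξ1 : ‖ξ‖ = 1 := by simpa using hξ
    have hpos : 0 < ‖p ξ - w‖ := (norm_nonneg w).trans_lt (hcon ξ hξ1)
    have hd : DiffContOnCl ℂ (fun z => (p z - w)⁻¹) (Metric.ball 0 1) := by
      refine DiffContOnCl.inv (hp.sub_const w).diffContOnCl fun z hz => ?_
      rw [closure_ball (0 : ℂ) one_ne_zero] at hz
      exact norm_pos_iff.1 (hη.trans_le (hcl z hz))
    have := Complex.norm_le_of_forall_mem_frontier_norm_le Metric.isBounded_ball hd
      (C := ‖p ξ - w‖⁻¹) (fun z hz => by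
        rw [frontier_ball (0 : ℂ) one_ne_zero] at hz
        rw [norm_inv]
        exact inv_anti₀ hpos (hmin hz))
      (subset_closure (Metric.mem_ball_self one_pos))
    rw [hp0, zero_sub, norm_inv, norm_neg] at this
    have hw : 0 < ‖w‖ := by
      have := hcl 0 (by simp)
      rw [hp0, zero_sub, norm_neg] at this
      exact hη.trans_le this
    exact absurd ((inv_le_inv₀ hw hpos).1 this) (not_le.2 (hcon ξ hξ1))
  obtain ⟨ξ, hξ1, hξw⟩ := hξ
  have hev : ∀ᶠ z in 𝓝 ξ, ‖p z - w‖ < ‖w‖ + η :=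
    (hp.continuous.sub continuous_const).norm.continuousAt.eventually_lt_const
      (hξw.trans_lt (lt_add_of_pos_right _ hη))
  obtain ⟨r, hr, hball⟩ := Metric.eventually_nhds_iff.1 hev
  exact ⟨ξ, hξ1, r, hr, fun z hz hzr => ⟨h z hz, (hball (by rwa [dist_eq_norm])).le⟩⟩

/-- Given an entire `p` with `p 0 = 0`, a point `z₀` and a boundary region are chosen so that any
`R` small at `z₀` and unbounded in the region can be rotated to make `p + u R` come close to `w`
where `R` is of moderate size. -/
lemma exists_point_and_sector {p : ℂ → ℂ} (hp : Differentiable ℂ p) (hp0 : p 0 = 0)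
    (w : ℂ) {η : ℝ} (hη : 0 < η) :
    ∃ z₀ ξ : ℂ, ∃ r : ℝ, ‖z₀‖ < 1 ∧ ‖ξ‖ = 1 ∧ 0 < r ∧
      ∀ R : ℂ → ℂ, ContinuousOn R (Metric.ball 0 1) → ‖R z₀‖ < η →
        (∀ K : ℕ, ∃ z, ‖z‖ < 1 ∧ ‖z - ξ‖ < r ∧ K < ‖R z‖) →
        ∃ z u : ℂ, ‖z‖ < 1 ∧ ‖u‖ = 1 ∧ ‖R z‖ ≤ ‖w‖ + η ∧ ‖p z + u * R z - w‖ < 2 * η := by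
  obtain ⟨z₀, hz₀, hpz₀⟩ | ⟨ξ, hξ, r, hr, hpξ⟩ := exists_near_or_exists_boundary hp hp0 w hη
  -- No rotation is needed here; the sector is an arbitrary choice.
  · refine ⟨z₀, 1, 1, hz₀, by simp, one_pos, fun R _ hRz₀ _ => ⟨z₀, 1, hz₀, by simp, ?_, ?_⟩⟩
    · linarith [norm_nonneg w]
    · calc ‖p z₀ + 1 * R z₀ - w‖ = ‖(p z₀ - w) + R z₀‖ := by ring_nf
        _ ≤ ‖p z₀ - w‖ + ‖R z₀‖ := norm_add_le _ _
        _ < 2 * η := by linarith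
  · set V := Metric.ball (0 : ℂ) 1 ∩ Metric.ball ξ r
    have hVpre : IsPreconnected V :=
      ((convex_ball (0 : ℂ) 1).inter (convex_ball ξ r)).isPreconnected
    have hmem : ∀ z : ℂ, z ∈ V ↔ ‖z‖ < 1 ∧ ‖z - ξ‖ < r := fun z => by
      simp [V, dist_eq_norm]
    obtain ⟨z₀, hz₀⟩ : V.Nonempty := by
      have hξcl : ξ ∈ closure (Metric.ball (0 : ℂ) 1) := by
        rw [closure_ball (0 : ℂ) one_ne_zero]
        simp [hξ]
      have := mem_closure_iff.1 hξcl _ Metric.isOpen_ball (Metric.mem_ball_self hr)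
      rwa [inter_comm] at this
    have hz₀' := (hmem z₀).1 hz₀
    refine ⟨z₀, ξ, r, hz₀'.1, hξ, hr, fun R hR hRz₀ hRunb => ?_⟩
    obtain ⟨K, hK⟩ := exists_nat_gt (‖w‖ + η)
    obtain ⟨z₁, hz₁, hz₁r, hz₁K⟩ := hRunb K
    -- `‖R‖` is below `‖p - w‖` at `z₀` and above it at `z₁`. At a crossing point `(w - p z) / R z`
    -- is unimodular and gives an exact hit.
    obtain ⟨z, hzV, hz⟩ := hVpre.intermediate_value₂ hz₀ ((hmem z₁).2 ⟨hz₁, hz₁r⟩)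
      (hR.mono inter_subset_left).norm
      (hp.continuous.sub continuous_const).norm.continuousOn
      (hRz₀.le.trans (hpξ z₀ hz₀'.1 hz₀'.2).1)
      (((hpξ z₁ hz₁ hz₁r).2.trans hK.le).trans hz₁K.le)
    have hz' := (hmem z).1 hzV
    have hbd := hpξ z hz'.1 hz'.2
    replace hz : ‖R z‖ = ‖p z - w‖ := hz
    have hRne : R z ≠ 0 := norm_pos_iff.1 (by rw [hz]; exact hη.trans_le hbd.1)
    refine ⟨z, (w - p z) / R z, hz'.1, ?_, by rw [hz]; exact hbd.2, ?_⟩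
    · rw [norm_div, hz, norm_sub_rev, div_self]
      exact (hη.trans_le hbd.1).ne'
    · rw [div_mul_cancel₀ _ hRne]
      simp [hη]

/-! ### Unboundedness near every boundary point -/

/-- The sequences `y` for which `∑ yₙ bₙ z^(n+1)` is unbounded on points of the dense sequence
lying in the unit disk and within distance `r` of `ξ`. -/
def unboundedNear (b : ℕ → ℂ) (ξ : ℂ) (r : ℝ) : Set (ℕ → ℂ) :=
  {y | ∀ K : ℕ, ∃ k, ‖denseSeq ℂ k‖ < 1 ∧ ‖denseSeq ℂ k - ξ‖ < r ∧
    K < ‖weightedSeries b y (denseSeq ℂ k)‖}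

lemma measurableSet_unboundedNear (b : ℕ → ℂ) (ξ : ℂ) (r : ℝ) :
    MeasurableSet (unboundedNear b ξ r) := by
  simp only [unboundedNear, ofPred_forall, ofPred_exists, ofPred_and]
  exact .iInter fun K => .iUnion fun k => (MeasurableSet.const _).inter
    ((MeasurableSet.const _).inter
      (measurableSet_lt measurable_const (measurable_weightedSeries b _).norm))

/-- Countably many test points make the event measurable; continuity of the series recovers all
points. -/
lemma HasBoundedCoeffs.mem_unboundedNear_iff (h : HasBoundedCoeffs b y) {ξ : ℂ} {r : ℝ} :
    y ∈ unboundedNear b ξ r ↔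
      ∀ K : ℕ, ∃ z : ℂ, ‖z‖ < 1 ∧ ‖z - ξ‖ < r ∧ K < ‖weightedSeries b y z‖ := by
  refine ⟨fun hy K => (hy K).imp' _ fun k hk => hk, fun hy K => ?_⟩
  obtain ⟨z, hz, hzr, hzK⟩ := hy K
  obtain ⟨k, hk, hkK⟩ := exists_denseSeq_mem (V := Metric.ball 0 1 ∩ Metric.ball ξ r)
    (O := {s : ℂ | (K : ℝ) < ‖s‖}) (Metric.isOpen_ball.inter Metric.isOpen_ball)
    (h.continuousOn.mono inter_subset_left)
    (isOpen_lt continuous_const continuous_norm) (z := z)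
    ⟨by simpa using hz, by simpa [dist_eq_norm] using hzr⟩ hzK
  exact ⟨k, by simpa using hk.1, by simpa [dist_eq_norm] using hk.2, hkK⟩

/-- The first `n` terms form a polynomial, bounded on the disk, so unboundedness is a tail event. -/
lemma HasBoundedCoeffs.splice_mem_unboundedNear_iff (h : HasBoundedCoeffs b y) {ξ : ℂ} {r : ℝ}
    (n : ℕ) (x : ℕ → ℂ) :
    splice n x y ∈ unboundedNear b ξ r ↔ splice n 0 y ∈ unboundedNear b ξ r := by
  rw [(h.spliced n x).mem_unboundedNear_iff, (h.spliced n 0).mem_unboundedNear_iff]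
  obtain ⟨M, hM⟩ := exists_nat_ge (∑ i ∈ Finset.range n, ‖x i * b i‖)
  have hpoly : ∀ z : ℂ, ‖z‖ < 1 → ‖∑ i ∈ Finset.range n, x i * b i * z ^ (i + 1)‖ ≤ M := by
    refine fun z hz => (norm_sum_le _ _).trans (le_trans ?_ hM)
    refine Finset.sum_le_sum fun i _ => ?_
    rw [norm_mul, norm_pow]
    exact mul_le_of_le_one_right (norm_nonneg _) (pow_le_one₀ (norm_nonneg z) hz.le)
  constructor
  · intro hy K
    obtain ⟨z, hz, hzr, hzK⟩ := hy (K + M)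
    refine ⟨z, hz, hzr, ?_⟩
    rw [h.weightedSeries_splice n x hz] at hzK
    push_cast at hzK
    linarith [norm_add_le (∑ i ∈ Finset.range n, x i * b i * z ^ (i + 1))
      (weightedSeries b (splice n 0 y) z), hpoly z hz]
  · intro hy K
    obtain ⟨z, hz, hzr, hzK⟩ := hy (K + M)
    refine ⟨z, hz, hzr, ?_⟩
    rw [h.weightedSeries_splice n x hz]
    push_cast at hzK
    have := norm_sub_le (∑ i ∈ Finset.range n, x i * b i * z ^ (i + 1) +
      weightedSeries b (splice n 0 y) z) (∑ i ∈ Finset.range n, x i * b i * z ^ (i + 1))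
    rw [add_sub_cancel_left] at this
    linarith [hpoly z hz]

lemma exists_finset_unimodular_net {ε : ℝ} (hε : 0 < ε) :
    ∃ t : Finset ℂ, (∀ v ∈ t, ‖v‖ = 1) ∧ ∀ u : ℂ, ‖u‖ = 1 → ∃ v ∈ t, ‖u - v‖ < ε := by
  obtain ⟨t, hts, htf, htc⟩ := (isCompact_sphere (0 : ℂ) 1).finite_cover_balls hε
  refine ⟨htf.toFinset, fun v hv => by simpa using hts (htf.mem_toFinset.1 hv), fun u hu => ?_⟩
  have := htc (show u ∈ Metric.sphere (0 : ℂ) 1 by simpa using hu)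
  simpa [dist_eq_norm] using this

/-- Multiplying the coefficient of `z^(n+1)` by `v^(n+1)` preserves the law and rotates the variable
by `v`. -/
lemma measure_unboundedNear_eq (ν : Measure ℂ) [IsProbabilityMeasure ν]
    (hν : ∀ u : ℂ, ‖u‖ = 1 → ν.map (fun z => u * z) = ν) (hν₂ : ∫⁻ z, ‖z‖ₑ ^ 2 ∂ν ≤ 1)
    (hb : ∑' n, ‖b n‖ₑ ^ 2 ≠ ⊤) {v : ℂ} (hv : ‖v‖ = 1) (ξ : ℂ) (r : ℝ) :
    (Measure.infinitePi fun _ : ℕ => ν) (unboundedNear b (v * ξ) r) =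
      (Measure.infinitePi fun _ : ℕ => ν) (unboundedNear b ξ r) := by
  have hu : ∀ n : ℕ, ‖v ^ (n + 1)‖ = 1 := fun n => by simp [hv]
  conv_rhs => rw [← map_rotate_infinitePi ν hν (fun n => v ^ (n + 1)) hu]
  rw [Measure.map_apply (by fun_prop) (measurableSet_unboundedNear b ξ r)]
  refine measure_congr ?_
  filter_upwards [ae_hasBoundedCoeffs ν hν₂ hb] with y hy
  refine propext ?_
  change y ∈ unboundedNear b (v * ξ) r ↔ (fun n => v ^ (n + 1) * y n) ∈ unboundedNear b ξ r
  rw [hy.mem_unboundedNear_iff, (hy.mul_unimodular hu).mem_unboundedNear_iff]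
  have hv0 : v ≠ 0 := norm_pos_iff.1 (by rw [hv]; exact one_pos)
  simp only [weightedSeries_pow_mul]
  refine forall_congr' fun K => ⟨fun ⟨z, hz, hzr, hzK⟩ => ⟨v⁻¹ * z, ?_, ?_, ?_⟩,
    fun ⟨z, hz, hzr, hzK⟩ => ⟨v * z, ?_, ?_, hzK⟩⟩
  · simpa [hv] using hz
  · have : v⁻¹ * z - ξ = v⁻¹ * (z - v * ξ) := by field_simp
    simpa [this, hv] using hzr
  · rwa [mul_inv_cancel_left₀ hv0]
  · simpa [hv] using hz
  · simpa [← mul_sub, hv] using hzr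

/-- If the random series is almost surely unbounded in the disk, it is almost surely unbounded
near each given point of the unit circle. -/
lemma ae_mem_unboundedNear (ν : Measure ℂ) [IsProbabilityMeasure ν]
    (hν : ∀ u : ℂ, ‖u‖ = 1 → ν.map (fun z => u * z) = ν) (hν₂ : ∫⁻ z, ‖z‖ₑ ^ 2 ∂ν ≤ 1)
    (hb : ∑' n, ‖b n‖ₑ ^ 2 ≠ ⊤)
    (hunb : ∀ᵐ y ∂(Measure.infinitePi fun _ : ℕ => ν),
      ∀ K : ℕ, ∃ z : ℂ, ‖z‖ < 1 ∧ K < ‖weightedSeries b y z‖)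
    {ξ : ℂ} (hξ : ‖ξ‖ = 1) {r : ℝ} (hr : 0 < r) :
    ∀ᵐ y ∂(Measure.infinitePi fun _ : ℕ => ν), y ∈ unboundedNear b ξ r := by
  set μ := Measure.infinitePi fun _ : ℕ => ν with hμ
  have hbdd := ae_hasBoundedCoeffs ν hν₂ hb
  -- Otherwise rotation makes the event null at every boundary point. Finitely many discs of radius
  -- `r` and the disk of radius `1 - r / 2` cover the unit disk, so the series would be bounded.
  have hpos : μ (unboundedNear b ξ r) ≠ 0 := by
    intro h0
    obtain ⟨t, ht1, htnet⟩ := exists_finset_unimodular_net (half_pos hr)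
    have hnull : ∀ᵐ y ∂μ, ∀ v ∈ t, y ∉ unboundedNear b v r := by
      rw [Finset.eventually_all]
      intro v hv
      have hξ0 : ξ ≠ 0 := norm_pos_iff.1 (by rw [hξ]; exact one_pos)
      have := measure_unboundedNear_eq ν hν hν₂ hb (v := v / ξ) (by simp [ht1 v hv, hξ]) ξ r
      rw [div_mul_cancel₀ _ hξ0, ← hμ, h0] at this
      exact measure_eq_zero_iff_ae_notMem.1 this
    obtain ⟨y, hy1, hy2, hy3⟩ := (hbdd.and (hunb.and hnull)).exists
    have hK : ∀ v ∈ t, ∃ K : ℕ, ∀ z : ℂ, ‖z‖ < 1 → ‖z - v‖ < r → ‖weightedSeries b y z‖ ≤ K := by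
      intro v hv
      have := hy3 v hv
      rw [hy1.mem_unboundedNear_iff] at this
      push Not at this
      exact this
    choose! K hK using hK
    obtain ⟨M, hM⟩ := hy1.bounded_of_le (r := 1 - r / 2) (by linarith)
    obtain ⟨M', hM'⟩ := exists_nat_ge M
    obtain ⟨z, hz, hzK⟩ := hy2 (M' + ∑ v ∈ t, K v)
    push_cast at hzK
    by_cases hzr : ‖z‖ ≤ 1 - r / 2
    · have : (0 : ℝ) ≤ ∑ v ∈ t, (K v : ℝ) := by positivity
      linarith [hM z hzr]
    · rw [not_le] at hzr
      have hsmall : ∃ u : ℂ, ‖u‖ = 1 ∧ ‖z - u‖ < r / 2 := by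
        rcases eq_or_ne z 0 with rfl | hz0
        · exact ⟨1, by simp, by simp at hzr ⊢; linarith⟩
        · refine ⟨z / ‖z‖, by simp [hz0], ?_⟩
          have hz0' : (‖z‖ : ℂ) ≠ 0 := by simpa using hz0
          have : z - z / ‖z‖ = (z / ‖z‖) * ((‖z‖ - 1 : ℝ) : ℂ) := by
            push_cast
            field_simp
          rw [this, norm_mul, norm_div, Complex.norm_real, Complex.norm_real, norm_norm,
            div_self (norm_ne_zero_iff.2 hz0), one_mul, Real.norm_eq_abs,
            abs_of_neg (by linarith)]
          linarith
      obtain ⟨u, hu, hzu⟩ := hsmall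
      obtain ⟨v, hv, huv⟩ := htnet u hu
      have hzv : ‖z - v‖ < r := by
        linarith [norm_sub_le_norm_sub_add_norm_sub z u v]
      have h1 := hK v hv z hz hzv
      have h2 : (K v : ℝ) ≤ ∑ v ∈ t, (K v : ℝ) :=
        Finset.single_le_sum (f := fun v => (K v : ℝ)) (fun _ _ => Nat.cast_nonneg _) hv
      have h3 : (0 : ℝ) ≤ M' := Nat.cast_nonneg _
      linarith
  -- For a tail event the constant can be its own probability, so positive probability becomes full.
  refine ae_of_le_measure_splice ν (measurableSet_unboundedNear b ξ r) hpos 0 fun n _ x => ?_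
  refine measure_mono_ae ?_
  filter_upwards [hbdd] with y hy hyU
  have hself : splice n y y = y := by
    ext i
    simp [splice]
  have : splice n y y ∈ unboundedNear b ξ r := by rwa [hself]
  rw [hy.splice_mem_unboundedNear_iff n y, ← hy.splice_mem_unboundedNear_iff n x] at this
  exact this

/-! ### Approaching a given value -/

/-- The sequences `y` for which `∑ yₙ bₙ z^(n+1)` comes within `δ` of `w` on points of the dense
sequence lying in the unit disk. -/
def hitsNear (b : ℕ → ℂ) (w : ℂ) (δ : ℝ) : Set (ℕ → ℂ) :=
  {y | ∃ k, ‖denseSeq ℂ k‖ < 1 ∧ ‖weightedSeries b y (denseSeq ℂ k) - w‖ < δ}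

lemma measurableSet_hitsNear (b : ℕ → ℂ) (w : ℂ) (δ : ℝ) : MeasurableSet (hitsNear b w δ) := by
  simp only [hitsNear, ofPred_exists, ofPred_and]
  exact .iUnion fun k => (MeasurableSet.const _).inter
    (measurableSet_lt ((measurable_weightedSeries b _).sub_const w).norm measurable_const)

lemma HasBoundedCoeffs.mem_hitsNear (h : HasBoundedCoeffs b y) {w z : ℂ} {δ : ℝ}
    (hz : ‖z‖ < 1) (hzw : ‖weightedSeries b y z - w‖ < δ) : y ∈ hitsNear b w δ := by
  obtain ⟨k, hk, hkw⟩ := exists_denseSeq_mem (O := Metric.ball w δ) Metric.isOpen_ball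
    h.continuousOn Metric.isOpen_ball (z := z) (by simpa using hz)
    (by simpa [dist_eq_norm] using hzw)
  exact ⟨k, by simpa using hk, by simpa [dist_eq_norm] using hkw⟩

lemma ae_mem_hitsNear (ν : Measure ℂ) [IsProbabilityMeasure ν]
    (hν : ∀ u : ℂ, ‖u‖ = 1 → ν.map (fun z => u * z) = ν) (hν₂ : ∫⁻ z, ‖z‖ₑ ^ 2 ∂ν ≤ 1)
    (hb : ∑' n, ‖b n‖ₑ ^ 2 ≠ ⊤)
    (hunb : ∀ᵐ y ∂(Measure.infinitePi fun _ : ℕ => ν),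
      ∀ K : ℕ, ∃ z : ℂ, ‖z‖ < 1 ∧ K < ‖weightedSeries b y z‖)
    (w : ℂ) {δ : ℝ} (hδ : 0 < δ) :
    ∀ᵐ y ∂(Measure.infinitePi fun _ : ℕ => ν), y ∈ hitsNear b w δ := by
  set μ := Measure.infinitePi fun _ : ℕ => ν with hμ
  have hbdd := ae_hasBoundedCoeffs ν hν₂ hb
  -- `2η` is lost in `exists_point_and_sector` and `2η` in replacing the rotation by one from the
  -- net.
  set η := δ / 4 with hη
  have hη0 : 0 < η := by positivity
  have hwη : 0 < ‖w‖ + η := by positivity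
  obtain ⟨n₀, hn₀⟩ := exists_forall_measure_weightedSeries_splice_lt ν hν hν₂ hb hη0
  -- The mesh is scaled to the bound `‖w‖ + η` on the tail at the chosen point. Fixing `t` before
  -- `n` and `x` makes the final constant uniform.
  obtain ⟨t, ht1, htnet⟩ := exists_finset_unimodular_net (ε := 2 * η / (‖w‖ + η)) (by positivity)
  refine ae_of_le_measure_splice ν (measurableSet_hitsNear b w δ)
    (c := 2⁻¹ / (t.card : ℝ≥0∞)) (by simp) n₀ fun n hn x => ?_
  set p : ℂ → ℂ := fun z => ∑ i ∈ Finset.range n, x i * b i * z ^ (i + 1) with hp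
  obtain ⟨z₀, ξ, r, hz₀, hξ, hr, hR⟩ := exists_point_and_sector (p := p)
    (by fun_prop) (by simp [hp]) w hη0
  set A : Set (ℕ → ℂ) := {y | splice n x y ∈ hitsNear b w δ}
  have hA : MeasurableSet A := measurable_splice_right n x (measurableSet_hitsNear b w δ)
  have hrot : ∀ v ∈ t, μ {y | (fun i => v * y i) ∈ A} = μ A := by
    intro v hv
    conv_rhs => rw [hμ, ← map_rotate_infinitePi ν hν (fun _ => v) (fun _ => ht1 v hv)]
    rw [Measure.map_apply (by fun_prop) hA]
    rfl
  -- With probability at least one half, some rotation in the net brings the sum close to `w`. The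
  -- rotated events are equally likely, so each has probability at least `1 / (2 * t.card)`.
  have hcover : 2⁻¹ ≤ μ (⋃ v ∈ t, {y | (fun i => v * y i) ∈ A}) := by
    refine (hn₀ n hn z₀ hz₀).trans (measure_mono_ae ?_)
    filter_upwards [hbdd, ae_mem_unboundedNear ν hν hν₂ hb hunb hξ hr] with y hy hyU hyz₀
    have hyU' : splice n 0 y ∈ unboundedNear b ξ r := by
      rw [← hy.splice_mem_unboundedNear_iff n y]
      have hself : splice n y y = y := by
        ext i
        simp [splice]
      rwa [hself]
    obtain ⟨z, u, hz, hu, hRz, hclose⟩ := hR (weightedSeries b (splice n 0 y))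
      (hy.spliced n 0).continuousOn hyz₀ ((hy.spliced n 0).mem_unboundedNear_iff.1 hyU')
    obtain ⟨v, hv, huv⟩ := htnet u hu
    have hyv : HasBoundedCoeffs b (fun i => v * y i) := hy.mul_unimodular fun _ => ht1 v hv
    refine mem_iUnion₂.2 ⟨v, hv, (hyv.spliced n x).mem_hitsNear hz ?_⟩
    rw [hyv.weightedSeries_splice n x hz, weightedSeries_splice_zero_mul]
    set R := weightedSeries b (splice n 0 y) z
    have hsmall : ‖(u - v) * R‖ ≤ 2 * η := by
      rw [norm_mul]
      calc ‖u - v‖ * ‖R‖ ≤ 2 * η / (‖w‖ + η) * (‖w‖ + η) := by gcongr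
        _ = 2 * η := div_mul_cancel₀ _ hwη.ne'
    calc ‖p z + v * R - w‖ = ‖(p z + u * R - w) - (u - v) * R‖ := by ring_nf
      _ ≤ ‖p z + u * R - w‖ + ‖(u - v) * R‖ := norm_sub_le _ _
      _ < 2 * η + 2 * η := by linarith
      _ = δ := by rw [hη]; ring
  have hsum : 2⁻¹ ≤ μ A * (t.card : ℝ≥0∞) := by
    refine hcover.trans ((measure_biUnion_finset_le _ _).trans ?_)
    rw [Finset.sum_congr rfl hrot, Finset.sum_const, nsmul_eq_mul, mul_comm]
  exact ENNReal.div_le_of_le_mul hsum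

/-- Density of the image of the disk for the coordinate model of the random series. -/
lemma ae_dense_image_weightedSeries (ν : Measure ℂ) [IsProbabilityMeasure ν]
    (hν : ∀ u : ℂ, ‖u‖ = 1 → ν.map (fun z => u * z) = ν) (hν₂ : ∫⁻ z, ‖z‖ₑ ^ 2 ∂ν ≤ 1)
    (hb : ∑' n, ‖b n‖ₑ ^ 2 ≠ ⊤)
    (hunb : ∀ᵐ y ∂(Measure.infinitePi fun _ : ℕ => ν),
      ∀ K : ℕ, ∃ z : ℂ, ‖z‖ < 1 ∧ K < ‖weightedSeries b y z‖) :
    ∀ᵐ y ∂(Measure.infinitePi fun _ : ℕ => ν),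
      Dense (weightedSeries b y '' Metric.ball (0 : ℂ) 1) := by
  have hall : ∀ᵐ y ∂(Measure.infinitePi fun _ : ℕ => ν),
      ∀ j m : ℕ, y ∈ hitsNear b (denseSeq ℂ j) (1 / ((m : ℝ) + 1)) :=
    ae_all_iff.2 fun j => ae_all_iff.2 fun m =>
      ae_mem_hitsNear ν hν hν₂ hb hunb _ Nat.one_div_pos_of_nat
  filter_upwards [hall] with y hy
  refine Dense.of_closure ?_
  refine (denseRange_denseSeq ℂ).mono ?_
  rintro _ ⟨j, rfl⟩
  refine Metric.mem_closure_iff.2 fun ε hε => ?_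
  obtain ⟨m, hm⟩ := exists_nat_one_div_lt hε
  obtain ⟨k, hk, hkw⟩ := hy j m
  refine ⟨_, mem_image_of_mem _ (show denseSeq ℂ k ∈ Metric.ball 0 1 by simpa using hk), ?_⟩
  rw [dist_comm, dist_eq_norm]
  exact hkw.trans hm

end

/-! ### Transfer from the coordinate model -/

theorem theorem1 {Ω : Type*} [MeasurableSpace Ω]
    (P : MeasureTheory.Measure Ω) [MeasureTheory.IsProbabilityMeasure P]
    (ζ : ℕ → Ω → ℂ) (a : ℕ → ℝ)
    -- the `ζ n`, `n ≥ 1`, are i.i.d. complex random variables ...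
    (hmeas : ∀ n, 1 ≤ n → Measurable (ζ n))
    (hindep : ProbabilityTheory.iIndepFun (fun n : ℕ => ζ (n + 1)) P)
    (hident : ∀ m n, 1 ≤ m → 1 ≤ n → ProbabilityTheory.IdentDistrib (ζ m) (ζ n) P P)
    -- ... with rotationally invariant law ...
    (hrot : ∀ n, 1 ≤ n → ∀ θ : ℝ, ProbabilityTheory.IdentDistrib
      (fun ω => Complex.exp ((θ : ℂ) * Complex.I) * ζ n ω) (ζ n) P P)
    -- ... and second absolute moment one
    (hvar : ∀ n, 1 ≤ n → ∫ ω, ‖ζ n ω‖ ^ 2 ∂P = 1)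
    -- nonnegative square summable coefficients, radius of convergence one
    (ha : ∀ n, 1 ≤ n → 0 ≤ a n)
    (hsum : Summable (fun n => a n ^ 2))
    (hradius : Filter.limsup (fun n : ℕ => a n ^ (1 / (n : ℝ))) Filter.atTop = 1)
    -- `F` is almost surely unbounded on the open unit disk
    (hunbdd : ∀ᵐ ω ∂P,
      ¬ Bornology.IsBounded (randomTaylorSeries ζ a ω '' Metric.ball (0 : ℂ) 1)) :
    ∀ᵐ ω ∂P, Dense (randomTaylorSeries ζ a ω '' Metric.ball (0 : ℂ) 1) := by
  have hmeas' : ∀ n : ℕ, Measurable (ζ (n + 1)) := fun n => hmeas _ (Nat.le_add_left 1 n)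
  set b : ℕ → ℂ := fun n => (a (n + 1) : ℂ)
  set ν : Measure ℂ := P.map (ζ 1) with hνdef
  have hζ1 : Measurable (ζ 1) := hmeas 1 le_rfl
  have hνprob : IsProbabilityMeasure ν := Measure.isProbabilityMeasure_map hζ1.aemeasurable
  have hν : ∀ u : ℂ, ‖u‖ = 1 → ν.map (fun z => u * z) = ν := by
    intro u hu
    have := (hrot 1 le_rfl u.arg).map_eq
    rw [hνdef, Measure.map_map (measurable_const_mul u) hζ1]
    rw [show Complex.exp (u.arg * Complex.I) = u by
      simpa [hu] using Complex.norm_mul_exp_arg_mul_I u] at this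
    exact this
  have hν₂ : ∫⁻ z, ‖z‖ₑ ^ 2 ∂ν ≤ 1 := by
    rw [hνdef, lintegral_map (by fun_prop) hζ1]
    have h1 := hvar 1 le_rfl
    -- A nonintegrable function would have integral `0` by default, not `1`.
    have hint : Integrable (fun ω => ‖ζ 1 ω‖ ^ 2) P := by
      by_contra hcon
      rw [integral_undef hcon] at h1
      exact zero_ne_one h1
    have h2 := ofReal_integral_eq_lintegral_ofReal hint (ae_of_all _ fun ω => by positivity)
    rw [h1, ENNReal.ofReal_one] at h2
    rw [h2]
    refine (lintegral_congr fun ω => ?_).le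
    rw [ENNReal.ofReal_pow (norm_nonneg _), ofReal_norm]
  have hb : ∑' n, ‖b n‖ₑ ^ 2 ≠ ⊤ := by
    have h1 : Summable fun n => a (n + 1) ^ 2 := (summable_nat_add_iff 1).2 hsum
    have h2 : ∀ n, ‖b n‖ₑ ^ 2 = ENNReal.ofReal (a (n + 1) ^ 2) := by
      intro n
      rw [← ofReal_norm, ← ENNReal.ofReal_pow (norm_nonneg _), Complex.norm_real,
        Real.norm_eq_abs, sq_abs]
    simp only [h2]
    exact h1.tsum_ofReal_ne_top
  set Y : Ω → ℕ → ℂ := fun ω n => ζ (n + 1) ω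
  have hY : Measurable Y := measurable_pi_lambda _ hmeas'
  have hlaw : P.map Y = Measure.infinitePi fun _ : ℕ => ν := by
    rw [hindep.map_fun_eq_infinitePi_map hmeas']
    congr 1
    ext1 n
    exact (hident _ _ (Nat.le_add_left 1 n) le_rfl).map_eq
  have hbdd := ae_hasBoundedCoeffs ν hν₂ hb
  have hbddY : ∀ᵐ ω ∂P, HasBoundedCoeffs b (Y ω) := by
    rw [← hlaw] at hbdd
    exact ae_of_ae_map hY.aemeasurable hbdd
  -- Centre `0` and radius `1` give the whole disk. The measurable form of unboundedness is what can
  -- be pushed forward to the law of `Y`.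
  have hmem : ∀ᵐ ω ∂P, Y ω ∈ unboundedNear b 0 1 := by
    filter_upwards [hunbdd, hbddY] with ω hω hωb
    rw [hωb.mem_unboundedNear_iff]
    by_contra hcon
    push Not at hcon
    obtain ⟨K, hK⟩ := hcon
    refine hω (isBounded_iff_forall_norm_le.2 ⟨K, ?_⟩)
    rintro _ ⟨z, hz, rfl⟩
    rw [mem_ball_zero_iff] at hz
    exact hK z hz (by simpa using hz)
  have hunb : ∀ᵐ y ∂(Measure.infinitePi fun _ : ℕ => ν),
      ∀ K : ℕ, ∃ z : ℂ, ‖z‖ < 1 ∧ K < ‖weightedSeries b y z‖ := by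
    have hmem' : ∀ᵐ y ∂(Measure.infinitePi fun _ : ℕ => ν), y ∈ unboundedNear b 0 1 := by
      rw [← hlaw]
      exact (ae_map_iff hY.aemeasurable (measurableSet_unboundedNear b 0 1)).2 hmem
    filter_upwards [hmem'] with y hy K
    obtain ⟨k, hk, -, hkK⟩ := hy K
    exact ⟨_, hk, hkK⟩
  have hdense := ae_dense_image_weightedSeries ν hν hν₂ hb hunb
  rw [← hlaw] at hdense
  exact ae_of_ae_map hY.aemeasurable hdense
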